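/- **Setting.** For $s\ge 1$, let $\mathcal P_s$ be the set of probability distributions on $\mathbb R$ with finite absolute $s$-th moment. For $\mathrm p\in\mathcal P_{1+r}$, $r\in(0,1)$, write $\mu_{\mathrm p}$ for its mean and $v_r=v_r(\mathrm p)=\mathbb E_{X\sim\mathrm p}|X-\mu_{\mathrm p}|^{1+r}$ for its absolute $(1+r)$-th central moment. Real numbers $X_1,\dots,X_n$ are $\alpha$-contaminated samples of $X_1^*,\dots,X_n^*$ if there are a set $S\subseteq\{1,\dots,n\}$ with $|S|\ge(1-\alpha)n$ and a map $\sigma$ from $\{1,\dots,n\}$ to itself, injective on $S$, with $X_i=X^*_{\sigma(i)}$ for all $i\in S$ (all but at most $\alpha n$ of the samples are, as a multiset, clean samples). Here $X_1^*,\dots,X_n^*$ are i.i.d. from $\mathrm p$, and the random variables $X_1,\dots,X_n$ may depend arbitrarily on all of them. Given $k$, let $I_1,\dots,I_k$ be a uniformly random family of pairwise disjoint subsets of $\{1,\dots,n\}$, each of size $m=\lfloor n/k\rfloor$, independent of the clean and contaminated samples. The median-of-means (MoM) estimator $\widehat\mu_{\mathrm{MoM}}$ is the $\lceil k/2\rceil$-th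 smallest of the block means $\widehat\mu_i=\frac1m\sum_{j\in I_i}X_j$, $i=1,\dots,k$. **Theorem 3.3.** Let $r\in(0,1)$. 1. (Upper bound.) There are a function $C:\mathbb R\to\mathbb R$ and constants $c_1,c_2>0$, depending only on $r$, with $$c_1\left(\tfrac12-\tfrac1\gamma\right)^{-\frac{2r+1}{1+r}}\le C(\gamma)\le c_2\left(\tfrac12-\tfrac1\gamma\right)^{-\frac{2r+1}{1+r}}\qquad\text{for all }\gamma\in(2,2.5],$$ such that for all $\gamma\in(2,2.5]$, all $n$, all $\delta>2\exp(-(1/2-1/\gamma)^2n)$, all $\mathrm p\in\mathcal P_{1+r}$ and all $0\le\alpha\le 0.4$, the MoM estimator with $$k=\max\left\{\left\lceil\frac{\log(2/\delta)}{(1/2-1/\gamma)^2}\right\rceil,\ \lceil\gamma\alpha n\rceil\right\}$$ blocks, evaluated at any $\alpha$-contaminated samples, satisfies $$|\widehat\mu_{\mathrm{MoM}}-\mu_{\mathrm p}|\le C(\gamma)\,v_r^{\frac1{1+r}}\left(\left(\frac{\log(2/\delta)}n\right)^{\frac r{1+r}}+\alpha^{\frac r{1+r}}\right)$$ with probability at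 least $1-\delta$. 2. (Optimality over $\mathcal P_{1+r}$.) There is a constant $c>0$, depending only on $r$, such that for all $n$, all $\delta\in[e^{-n},1/4]$, all $0\le\alpha\le 0.4$, all $v>0$ and every (possibly randomized) estimator $\widehat\mu=\widehat\mu(X_1,\dots,X_n)$ of the mean, there are a distribution $\mathrm p\in\mathcal P_{1+r}$ with $v_r(\mathrm p)=v$ and an adversarial attack, that is, a measurable map $A:\mathbb R^n\to\mathbb R^n$ turning every sample $(X_1^*,\dots,X_n^*)$ into $\alpha$-contaminated samples of it, such that $\widehat\mu$ evaluated at $A(X_1^*,\dots,X_n^*)$ satisfies $$|\widehat\mu-\mu_{\mathrm p}|\ge c\,v^{\frac1{1+r}}\left(\left(\frac{\log(2/\delta)}n\right)^{\frac r{1+r}}+\alpha^{\frac r{1+r}}\right)$$ with probability at least $\delta$. -/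

import Mathlib

open MeasureTheory ProbabilityTheory

namespace MoM

/-- The mean of a distribution on the real line. -/
noncomputable def mean (p : Measure ℝ) : ℝ := ∫ x, x ∂p

/-- The class of probability distributions on the real line with finite absolute `s`-th moment. -/
structure FiniteMoment (s : ℝ) (p : Measure ℝ) : Prop where
  isProbabilityMeasure : IsProbabilityMeasure p
  integrable : Integrable (fun x : ℝ => |x| ^ s) p

/-- The absolute central moment `v_r = E |X - μ_p| ^ (1 + r)`. -/
noncomputable def centralMoment (r : ℝ) (p : Measure ℝ) : ℝ :=
  ∫ x, |x - mean p| ^ (1 + r) ∂p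

/-- The error rate
`v ^ (1 / (1 + r)) * ((log (2 / δ) / n) ^ (r / (1 + r)) + α ^ (r / (1 + r)))`. -/
noncomputable def rate (r v : ℝ) (n : ℕ) (δ α : ℝ) : ℝ :=
  v ^ (1 / (1 + r)) * ((Real.log (2 / δ) / n) ^ (r / (1 + r)) + α ^ (r / (1 + r)))

/-- `x` is an `α`-contamination of the clean sample `xs`: the entries of `x` at some set `S` of at
least `(1 - α) n` indices form a sub-multiset of the entries of `xs`. The matching `σ` of entries
of `x` with entries of `xs` is injective on `S` but may move positions; the remaining entries of
`x` are arbitrary. -/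
def IsContamination {n : ℕ} (α : ℝ) (xs x : Fin n → ℝ) : Prop :=
  ∃ (S : Finset (Fin n)) (σ : Fin n → Fin n),
    (1 - α) * n ≤ S.card ∧ Set.InjOn σ S ∧ ∀ i ∈ S, x i = xs (σ i)

/-- Families of `k` pairwise disjoint blocks of `m` indices in `{0, …, n - 1}`. -/
def Blocks (n k m : ℕ) : Type :=
  {I : Fin k → Finset (Fin n) // (∀ i, (I i).card = m) ∧ Pairwise fun i j => Disjoint (I i) (I j)}

instance (n k m : ℕ) : MeasurableSpace (Blocks n k m) := ⊤

instance (n k m : ℕ) : DiscreteMeasurableSpace (Blocks n k m) := ⟨fun _ => trivial⟩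

noncomputable instance (n k m : ℕ) : Fintype (Blocks n k m) := by
  classical
  unfold Blocks
  infer_instance

/-- The mean of the sample `x` over the `i`-th block. -/
noncomputable def blockMean {n k m : ℕ} (I : Blocks n k m) (x : Fin n → ℝ) (i : Fin k) : ℝ :=
  (∑ j ∈ I.1 i, x j) / m

/-- The `j`-th order statistic (`1 ≤ j ≤ k`): the `j`-th entry of the non-decreasing
rearrangement of `y`. Outside that range the value is irrelevant. -/
noncomputable def orderStatistic {k : ℕ} (y : Fin k → ℝ) (j : ℕ) : ℝ :=
  if h : j - 1 < k then y (Tuple.sort y ⟨j - 1, h⟩) else 0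

/-- The median-of-means estimator: the `⌈k / 2⌉`-th order statistic of the block means. -/
noncomputable def estimator {n k m : ℕ} (I : Blocks n k m) (x : Fin n → ℝ) : ℝ :=
  orderStatistic (blockMean I x) ⌈(k : ℝ) / 2⌉₊

/-- The number of blocks `k = max {⌈log (2 / δ) / (1 / 2 - 1 / γ) ^ 2⌉, ⌈γ α n⌉}`. -/
noncomputable def numBlocks (γ δ α : ℝ) (n : ℕ) : ℕ :=
  max ⌈Real.log (2 / δ) / (1 / 2 - 1 / γ) ^ 2⌉₊ ⌈γ * α * n⌉₊

/-- The data of a mean estimation experiment with `k` random blocks under adversarial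
contamination: `Xs` are i.i.d. samples from `p`, `X` are the contaminated samples (which may depend
on all of `Xs` and on extra randomness), and `I` is a uniformly random family of `k` disjoint
blocks of size `⌊n / k⌋`, drawn independently of the clean and contaminated samples. -/
structure IsExperiment {Ω : Type*} [MeasurableSpace Ω] (P : Measure Ω) (p : Measure ℝ) (α : ℝ)
    {n k : ℕ} (Xs X : Fin n → Ω → ℝ) (I : Ω → Blocks n k (n / k)) : Prop where
  law : ∀ i, HasLaw (Xs i) p P
  indep : iIndepFun Xs P
  aemeasurable : ∀ i, AEMeasurable (X i) P
  contamination : ∀ᵐ ω ∂P, IsContamination α (fun i => Xs i ω) (fun i => X i ω)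
  blocks_law : HasLaw I (uniformOn Set.univ) P
  blocks_indep : IndepFun (fun ω => (fun i => Xs i ω, fun i => X i ω)) I P

end MoM

/-! Upper bound. Put ε = 1/2 - 1/γ. The blocks are disjoint, so at most αn ≤ k/γ of them contain a
corrupted entry. Hence the median can be far from the mean only if at least k/2 - k/γ = εk clean
block means are far. The variance may be infinite, so Chebyshev is replaced by the von Bahr–Esseen
inequality `integral_abs_sum_rpow_le` and Markov: a clean block is far with probability at most ε/4.
Hoeffding's inequality over the independent blocks then bounds the failure probability by exp(-ε²k)
≤ δ/2. Contamination may also move entries, so clean and contaminated samples are compared only up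
to a permutation that depends on the outcome. It disappears on averaging over the uniform blocks,
which are independent of the samples (`IsExperiment.measureReal_half_le_card_farEntries_le`).

Lower bound. Take mass q at b = ±a and the rest at 0, so that the means are ±qa. On the zero sample
an estimator cannot know the sign, and for one sign it errs by at least qa with probability at least
1/2. The zero sample is observed with probability at least 2δ, either because q is of order
log(1/δ)/n and the clean sample vanishes, or because q = α/2 and the adversary can erase all
non-zero entries. For fixed v, a is of order (v/q)^(1/(1+r)), so qa has the order of the rate. -/

namespace MoM

/-! ### Moments of sums of independent variables -/

/-- The signed power `x ↦ sgn x * |x| ^ r` is `r`-Hölder with constant `2`. -/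
lemma abs_signedPow_sub_le {r : ℝ} (hr0 : 0 < r) (hr1 : r ≤ 1) (x y : ℝ) :
    |x * |x| ^ (r - 1) - y * |y| ^ (r - 1)| ≤ 2 * |x - y| ^ r := by
  have key : ∀ z : ℝ, 0 ≤ z → z * |z| ^ (r - 1) = z ^ r := by
    intro z hz
    rcases hz.eq_or_lt with rfl | hz
    · simp [hr0.ne']
    · rw [abs_of_pos hz, Real.rpow_sub_one hz.ne']; field_simp
  -- Equal signs: subadditivity of t ↦ t^r gives constant 1. The 2 is needed only for opposite
  -- signs, where each term is at most (x + y)^r.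
  have same : ∀ x y : ℝ, 0 ≤ x → x ≤ y →
      |x * |x| ^ (r - 1) - y * |y| ^ (r - 1)| ≤ 2 * |x - y| ^ r := by
    intro x y hx hxy
    rw [key x hx, key y (hx.trans hxy), abs_sub_comm, abs_sub_comm x y,
      abs_of_nonneg (sub_nonneg.2 (Real.rpow_le_rpow hx hxy hr0.le)),
      abs_of_nonneg (sub_nonneg.2 hxy)]
    have h := Real.rpow_add_le_add_rpow hx (sub_nonneg.2 hxy) hr0.le hr1
    rw [add_sub_cancel] at h
    have := Real.rpow_nonneg (sub_nonneg.2 hxy) r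
    linarith
  have opp : ∀ x y : ℝ, 0 ≤ x → 0 ≤ y →
      |x * |x| ^ (r - 1) - -y * |-y| ^ (r - 1)| ≤ 2 * |x - -y| ^ r := by
    intro x y hx hy
    rw [abs_neg, neg_mul, key x hx, key y hy, sub_neg_eq_add, sub_neg_eq_add,
      abs_of_nonneg (add_nonneg (Real.rpow_nonneg hx _) (Real.rpow_nonneg hy _)),
      abs_of_nonneg (add_nonneg hx hy)]
    have h1 := Real.rpow_le_rpow hx (le_add_of_nonneg_right hy) hr0.le
    have h2 := Real.rpow_le_rpow hy (le_add_of_nonneg_left hx) hr0.le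
    linarith
  have nonneg : ∀ x y : ℝ, 0 ≤ x → 0 ≤ y →
      |x * |x| ^ (r - 1) - y * |y| ^ (r - 1)| ≤ 2 * |x - y| ^ r := by
    intro x y hx hy
    rcases le_total x y with h | h
    · exact same x y hx h
    · rw [abs_sub_comm, abs_sub_comm x y]; exact same y x hy h
  rcases le_total 0 x with hx | hx <;> rcases le_total 0 y with hy | hy
  · exact nonneg x y hx hy
  · simpa using opp x (-y) hx (neg_nonneg.2 hy)
  · rw [abs_sub_comm, abs_sub_comm x y]
    simpa using opp y (-x) hy (neg_nonneg.2 hx)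
  · have h := nonneg (-x) (-y) (neg_nonneg.2 hx) (neg_nonneg.2 hy)
    rw [abs_neg, abs_neg, neg_mul, neg_mul, neg_sub_neg, neg_sub_neg, abs_sub_comm,
      abs_sub_comm y x] at h
    exact h

/-- First-order expansion of `x ↦ |x| ^ (1 + r)` with a remainder of order `|b| ^ (1 + r)`. -/
lemma abs_add_rpow_le {r : ℝ} (hr0 : 0 < r) (hr1 : r ≤ 1) (a b : ℝ) :
    |a + b| ^ (1 + r) ≤
      |a| ^ (1 + r) + (1 + r) * (a * |a| ^ (r - 1)) * b + 4 * |b| ^ (1 + r) := by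
  -- Subtracting the tangent at a leaves a derivative that the Hölder bound controls by 2(1+r)|b|^r
  -- ≤ 4|b|^r; the mean value inequality then yields the remainder.
  let g : ℝ → ℝ := fun t => |t| ^ (1 + r) - (1 + r) * (a * |a| ^ (r - 1)) * t
  have hg : ∀ t ∈ Set.uIcc a (a + b), HasDerivWithinAt g
      ((1 + r) * (t * |t| ^ (r - 1) - a * |a| ^ (r - 1))) (Set.uIcc a (a + b)) t := by
    intro t _
    refine HasDerivAt.hasDerivWithinAt ?_
    have h1 := hasDerivAt_abs_rpow t (p := 1 + r) (by linarith)
    have h2 := (hasDerivAt_id t).const_mul ((1 + r) * (a * |a| ^ (r - 1)))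
    refine (h1.sub h2).congr_deriv ?_
    rw [show 1 + r - 2 = r - 1 by ring]; ring
  have hb : ∀ t ∈ Set.uIcc a (a + b),
      ‖(1 + r) * (t * |t| ^ (r - 1) - a * |a| ^ (r - 1))‖ ≤ 4 * |b| ^ r := by
    intro t ht
    have hta : |t - a| ≤ |b| := by
      have := Set.abs_sub_left_of_mem_uIcc ht
      rwa [add_sub_cancel_left] at this
    rw [norm_mul, Real.norm_eq_abs, Real.norm_eq_abs, abs_of_pos (by linarith : 0 < 1 + r)]
    have h1 := abs_signedPow_sub_le hr0 hr1 t a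
    have h2 := Real.rpow_le_rpow (abs_nonneg _) hta hr0.le
    have h3 := abs_nonneg (t * |t| ^ (r - 1) - a * |a| ^ (r - 1))
    nlinarith
  have h := (convex_uIcc a (a + b)).norm_image_sub_le_of_norm_hasDerivWithin_le hg hb
    Set.left_mem_uIcc Set.right_mem_uIcc
  have h' := (le_abs_self _).trans h
  rw [add_sub_cancel_left, Real.norm_eq_abs] at h'
  have hbr : |b| ^ (1 + r) = |b| ^ r * |b| := by
    rcases eq_or_ne b 0 with rfl | hb0
    · simp [(by linarith : 1 + r ≠ 0)]
    · rw [add_comm, Real.rpow_add_one (abs_pos.2 hb0).ne']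
  simp only [g] at h'
  rw [hbr]
  linarith

section MomentInequality

variable {Ω : Type*} [MeasurableSpace Ω] {P : Measure Ω}

lemma integrable_abs_rpow_iff_memLp {r : ℝ} (hr0 : 0 < r) {X : Ω → ℝ}
    (hX : AEStronglyMeasurable X P) :
    Integrable (fun ω => |X ω| ^ (1 + r)) P ↔ MemLp X (ENNReal.ofReal (1 + r)) P := by
  have h := integrable_norm_rpow_iff (p := ENNReal.ofReal (1 + r)) hX
    (by simp; linarith) (by simp)
  rwa [ENNReal.toReal_ofReal (by linarith)] at h

/-- The **von Bahr–Esseen inequality**: the `(1 + r)`-th absolute moment of a sum of independent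
centred random variables is at most a constant times the sum of their `(1 + r)`-th moments. -/
theorem integral_abs_sum_rpow_le {ι : Type*} [IsProbabilityMeasure P] {r : ℝ} (hr0 : 0 < r)
    (hr1 : r ≤ 1) {X : ι → Ω → ℝ} (hm : ∀ i, Measurable (X i)) (hind : iIndepFun X P)
    (hL : ∀ i, MemLp (X i) (ENNReal.ofReal (1 + r)) P) (h0 : ∀ i, ∫ ω, X i ω ∂P = 0)
    (s : Finset ι) :
    ∫ ω, |∑ i ∈ s, X i ω| ^ (1 + r) ∂P ≤ 4 * ∑ i ∈ s, ∫ ω, |X i ω| ^ (1 + r) ∂P := by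
  classical
  induction s using Finset.induction_on with
  | empty => simp [(by linarith : 1 + r ≠ 0)]
  | insert i s hi ih =>
    set S : Ω → ℝ := fun ω => ∑ j ∈ s, X j ω with hS
    have hSm : Measurable S := Finset.measurable_fun_sum s fun j _ => hm j
    have hSL : MemLp S (ENNReal.ofReal (1 + r)) P := memLp_finsetSum s fun j _ => hL j
    have hone : (1 : ENNReal) ≤ ENNReal.ofReal (1 + r) := by
      rw [← ENNReal.ofReal_one]; exact ENNReal.ofReal_le_ofReal (by linarith)
    have hXi : Integrable (X i) P := (hL i).integrable hone
    have hSI := (integrable_abs_rpow_iff_memLp hr0 hSm.aestronglyMeasurable).2 hSL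
    have hXI := (integrable_abs_rpow_iff_memLp hr0 (hm i).aestronglyMeasurable).2 (hL i)
    have hsum : ∀ ω, ∑ j ∈ insert i s, X j ω = S ω + X i ω := fun ω => by
      rw [Finset.sum_insert hi, add_comm]
    have hSXI := (integrable_abs_rpow_iff_memLp hr0
      (hSm.add (hm i)).aestronglyMeasurable).2 (hSL.add (hL i))
    -- In the expansion around S the linear term is a multiple of φ(S) X_i, whose integral vanishes
    -- by independence and centring. Integrability of φ(S) comes from |S|^r ≤ |S|^(1+r) + 1.
    let φ : ℝ → ℝ := fun t => t * |t| ^ (r - 1)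
    have hφ : Measurable φ := by fun_prop
    have hφI : Integrable (fun ω => φ (S ω)) P := by
      refine (hSI.add (integrable_const 1)).mono (hφ.comp hSm).aestronglyMeasurable
        (Filter.Eventually.of_forall fun ω => ?_)
      have h1 := abs_signedPow_sub_le hr0 hr1 (S ω) 0
      simp only [zero_mul, sub_zero] at h1
      have hle : |φ (S ω)| ≤ |S ω| ^ r := by
        simp only [φ, abs_mul, abs_of_nonneg (Real.rpow_nonneg (abs_nonneg (S ω)) (r - 1))]
        rcases eq_or_ne (S ω) 0 with h | h
        · simp [h, hr0.ne']
        · rw [Real.rpow_sub_one (abs_pos.2 h).ne']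
          have := abs_pos.2 h
          field_simp
          rfl
      have h2 : |S ω| ^ r ≤ |S ω| ^ (1 + r) + 1 := by
        rcases le_total 1 |S ω| with h | h
        · have := Real.rpow_le_rpow_of_exponent_le h (by linarith : r ≤ 1 + r)
          linarith
        · have := Real.rpow_le_one (abs_nonneg _) h hr0.le
          have := Real.rpow_nonneg (abs_nonneg (S ω)) (1 + r)
          linarith
      rw [Real.norm_eq_abs, Real.norm_eq_abs]
      exact (hle.trans h2).trans (le_abs_self _)
    have hindS : IndepFun (fun ω => φ (S ω)) (X i) P := by
      have := hind.indepFun_finsetSum_of_notMem hm hi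
      have h2 := this.comp hφ measurable_id
      have h3 : φ ∘ (∑ j ∈ s, X j) = fun ω => φ (S ω) := by ext ω; simp [hS]
      rwa [h3] at h2
    have hprodI : Integrable (fun ω => φ (S ω) * X i ω) P := hindS.integrable_mul hφI hXi
    have hprod0 : ∫ ω, φ (S ω) * X i ω ∂P = 0 := by
      rw [hindS.integral_fun_mul_eq_mul_integral hφI.1 hXi.1, h0 i, mul_zero]
    simp_rw [hsum]
    rw [Finset.sum_insert hi]
    calc ∫ ω, |S ω + X i ω| ^ (1 + r) ∂P
        ≤ ∫ ω, (|S ω| ^ (1 + r) + (1 + r) * (φ (S ω) * X i ω) + 4 * |X i ω| ^ (1 + r)) ∂P := by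
          refine integral_mono hSXI ((hSI.add (hprodI.const_mul _)).add (hXI.const_mul 4))
            fun ω => ?_
          have := abs_add_rpow_le hr0 hr1 (S ω) (X i ω)
          simp only [φ]; linarith
      _ = ∫ ω, |S ω| ^ (1 + r) ∂P + 4 * ∫ ω, |X i ω| ^ (1 + r) ∂P := by
          have hSP : Integrable (fun ω => |S ω| ^ (1 + r) + (1 + r) * (φ (S ω) * X i ω)) P :=
            hSI.add (hprodI.const_mul _)
          rw [integral_add hSP (hXI.const_mul 4), integral_add hSI (hprodI.const_mul _), integral_const_mul, integral_const_mul, hprod0]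
          ring
      _ ≤ _ := by linarith

end MomentInequality

/-! ### The median and the far entries -/

section OrderStatistic

/-- The indices of the entries of `y` that are further than `B` from `μ`. -/
noncomputable def farEntries {k : ℕ} (y : Fin k → ℝ) (μ B : ℝ) : Finset (Fin k) :=
  Finset.univ.filter fun i => B < |y i - μ|

/-- If the median is far from `μ`, so is at least half of the entries. -/
lemma half_le_card_farEntries {k : ℕ} (hk : 0 < k) (y : Fin k → ℝ) {μ B : ℝ}
    (h : B < |orderStatistic y ⌈(k : ℝ) / 2⌉₊ - μ|) :
    (k : ℝ) / 2 ≤ (farEntries y μ B).card := by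
  have hk' : (0 : ℝ) < k := by exact_mod_cast hk
  set c := ⌈(k : ℝ) / 2⌉₊ with hc
  have hc0 : 0 < c := Nat.ceil_pos.2 (by positivity)
  have hc1 : (k : ℝ) / 2 ≤ c := Nat.le_ceil _
  have hc2 : (c : ℝ) < k / 2 + 1 := Nat.ceil_lt_add_one (by positivity)
  have hck : c - 1 < k := by
    have : (c : ℝ) < k + 1 := by linarith
    have : c < k + 1 := by exact_mod_cast this
    omega
  rw [orderStatistic, dif_pos hck] at h
  have hmono := Tuple.monotone_sort y
  have himage : ∀ T : Finset (Fin k), (∀ i ∈ T, B < |y (Tuple.sort y i) - μ|) →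
      T.card ≤ (farEntries y μ B).card := fun T hT =>
    Finset.card_le_card_of_injOn (Tuple.sort y) (fun i hi => by simpa [farEntries] using hT i hi)
      (Tuple.sort y).injective.injOn
  rcases lt_abs.1 h with h | h
  -- A median too large makes the k - c + 1 sorted positions from c - 1 on far; one too small makes
  -- the first c far. Both counts are at least k/2, since k/2 ≤ c < k/2 + 1.
  · have := himage (Finset.Ici ⟨c - 1, hck⟩) fun i hi => by
      have h1 := hmono (Finset.mem_Ici.1 hi)
      simp only [Function.comp_apply] at h1
      exact lt_abs.2 (Or.inl (by linarith))
    rw [Fin.card_Ici] at this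
    have h2 : k + 1 ≤ (farEntries y μ B).card + c := by simp only at this; omega
    have h3 : (k : ℝ) + 1 ≤ (farEntries y μ B).card + c := by exact_mod_cast h2
    linarith
  · have := himage (Finset.Iic ⟨c - 1, hck⟩) fun i hi => by
      have h1 := hmono (Finset.mem_Iic.1 hi)
      simp only [Function.comp_apply] at h1
      exact lt_abs.2 (Or.inr (by linarith))
    rw [Fin.card_Iic] at this
    have h2 : c ≤ (farEntries y μ B).card := by simp only at this; omega
    have h3 : (c : ℝ) ≤ (farEntries y μ B).card := by exact_mod_cast h2
    linarith

end OrderStatistic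

/-! ### Effect of contamination on blocks -/

section Contamination

variable {n k m : ℕ}

/-- The action of a permutation of the indices on families of blocks. -/
def Blocks.perm (τ : Equiv.Perm (Fin n)) (J : Blocks n k m) : Blocks n k m :=
  ⟨fun i => (J.1 i).map τ.toEmbedding, fun i => by rw [Finset.card_map, J.2.1 i],
    fun i j hij => (Finset.disjoint_map _).2 (J.2.2 hij)⟩

lemma Blocks.perm_injective (τ : Equiv.Perm (Fin n)) :
    Function.Injective (Blocks.perm τ : Blocks n k m → Blocks n k m) := by
  intro J J' h
  apply Subtype.ext
  funext i
  have := congrFun (congrArg Subtype.val h) i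
  exact Finset.map_injective _ this

lemma blockMean_perm (τ : Equiv.Perm (Fin n)) (J : Blocks n k m) (x : Fin n → ℝ) (i : Fin k) :
    blockMean (J.perm τ) x i = (∑ j ∈ J.1 i, x (τ j)) / m := by
  simp [blockMean, Blocks.perm]

/-- Up to a permutation of the blocks, contamination creates at most `α n` new far block means. -/
lemma IsContamination.exists_perm {α : ℝ} {xs x : Fin n → ℝ} (h : IsContamination α xs x) :
    ∃ τ : Equiv.Perm (Fin n), ∀ (k m : ℕ) (J : Blocks n k m) (μ B : ℝ),
      ((farEntries (blockMean J x) μ B).card : ℝ) ≤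
        (farEntries (blockMean (J.perm τ) xs) μ B).card + α * n := by
  classical
  obtain ⟨S, σ, hS, hσ, hx⟩ := h
  -- The matching is extended from S to a permutation of all indices; its values off S play no role.
  obtain ⟨g, hg⟩ := Finset.exists_equiv_extend_of_card_eq (t := (Finset.univ : Finset (Fin n)))
    (by simp) (Finset.subset_univ (S.image σ)) hσ
  refine ⟨g.trans (Equiv.subtypeUnivEquiv fun i => Finset.mem_univ i), fun k m J μ B => ?_⟩
  set τ : Equiv.Perm (Fin n) := g.trans (Equiv.subtypeUnivEquiv fun i => Finset.mem_univ i)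
  have hτ : ∀ i ∈ S, x i = xs (τ i) := fun i hi => by rw [hx i hi, ← hg i hi]; rfl
  set E : Finset (Fin k) := Finset.univ.filter fun i => ¬ J.1 i ⊆ S
  have hsub : farEntries (blockMean J x) μ B ⊆
      farEntries (blockMean (J.perm τ) xs) μ B ∪ E := by
    intro i hi
    by_cases hiS : J.1 i ⊆ S
    · refine Finset.mem_union_left _ ?_
      simp only [farEntries, Finset.mem_filter, Finset.mem_univ, true_and] at hi ⊢
      rw [blockMean_perm, ← Finset.sum_congr rfl fun j hj => hτ j (hiS hj)]
      exact hi
    · exact Finset.mem_union_right _ (by simp [E, hiS])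
  -- A corrupted index chosen in each block that leaves S gives an injection, because the blocks are
  -- disjoint.
  have hE : E.card ≤ Sᶜ.card := by
    have hex : ∀ i ∈ E, ∃ j ∈ J.1 i, j ∉ S := fun i hi => by
      simpa [E, Finset.not_subset] using hi
    rcases E.eq_empty_or_nonempty with h0 | ⟨i₀, hi₀⟩
    · simp [h0]
    have : Nonempty (Fin n) := ⟨(hex i₀ hi₀).choose⟩
    choose! f hf hfS using hex
    refine Finset.card_le_card_of_injOn f (fun i hi => by simpa using hfS i hi) ?_
    intro i hi i' hi' hii
    by_contra hne
    exact Finset.disjoint_left.1 (J.2.2 hne) (hf i hi) (hii ▸ hf i' hi')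
  have hSc : (Sᶜ.card : ℝ) ≤ α * n := by
    rw [Finset.card_compl, Fintype.card_fin, Nat.cast_sub (by simpa using S.card_le_univ)]
    linarith
  have h1 : ((farEntries (blockMean J x) μ B).card : ℝ) ≤
      (farEntries (blockMean (J.perm τ) xs) μ B).card + E.card := by
    exact_mod_cast (Finset.card_le_card hsub).trans (Finset.card_union_le _ _)
  have h2 : (E.card : ℝ) ≤ Sᶜ.card := by exact_mod_cast hE
  linarith

lemma measurable_blockMean (J : Blocks n k m) (i : Fin k) :
    Measurable fun x : Fin n → ℝ => blockMean J x i := by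
  unfold blockMean; fun_prop

lemma measurable_card_farEntries (J : Blocks n k m) (μ B : ℝ) :
    Measurable fun x : Fin n → ℝ => ((farEntries (blockMean J x) μ B).card : ℝ) := by
  have h : (fun x : Fin n → ℝ => ((farEntries (blockMean J x) μ B).card : ℝ)) =
      fun x => ∑ i, Set.indicator {z : Fin n → ℝ | B < |blockMean J z i - μ|} 1 x := by
    ext x
    simp [farEntries, Set.indicator_apply, Finset.sum_boole]
  rw [h]
  refine Finset.measurable_fun_sum _ fun i _ => measurable_one.indicator ?_
  exact measurableSet_lt measurable_const ((measurable_blockMean J i).sub_const μ).abs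

end Contamination

/-! ### Concentration of the number of far blocks -/

section Concentration

variable {ι : Type*} [Fintype ι] {p : Measure ℝ} [IsProbabilityMeasure p]

/-- Functions of disjoint sets of coordinates are independent under a product measure. -/
lemma indepFun_of_dependsOn {f g : (ι → ℝ) → ℝ} (hf : Measurable f) (hg : Measurable g)
    {S T : Finset ι} (hST : Disjoint S T) (hfS : DependsOn f S) (hgT : DependsOn g T) :
    IndepFun f g (Measure.pi fun _ : ι => p) := by
  classical
  have hind : iIndepFun (fun (i : ι) (x : ι → ℝ) => x i) (Measure.pi fun _ : ι => p) :=
    iIndepFun_pi (X := fun _ x => x) fun _ => aemeasurable_id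
  have h := hind.indepFun_finset S T hST fun i => measurable_pi_apply i
  -- Filling the missing coordinates with 0 turns a function of the coordinates in U into one on U →
  -- ℝ, to which independence of subfamilies applies.
  let ext (U : Finset ι) (y : U → ℝ) (j : ι) : ℝ := if h : j ∈ U then y ⟨j, h⟩ else 0
  have hext : ∀ U, Measurable (ext U) := fun U => measurable_pi_lambda _ fun j => by
    by_cases h : j ∈ U
    · simpa [ext, h] using measurable_pi_apply _
    · simp [ext, h]
  have h2 := h.comp (hf.comp (hext S)) (hg.comp (hext T))
  have hfe : (f ∘ ext S) ∘ (fun (a : ι → ℝ) (i : S) => a i) = f := by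
    ext x
    exact hfS fun i hi => by simp [ext, Finset.mem_coe.1 hi]
  have hge : (g ∘ ext T) ∘ (fun (a : ι → ℝ) (i : T) => a i) = g := by
    ext x
    exact hgT fun i hi => by simp [ext, Finset.mem_coe.1 hi]
  rwa [hfe, hge] at h2

variable {n k m : ℕ}

/-- The number of far blocks of a clean sample concentrates around its mean. -/
lemma measureReal_le_card_farEntries_le (hk : 0 < k) (J : Blocks n k m) {μ B ε : ℝ} (hε : 0 < ε)
    (hq : ∀ i, (Measure.pi fun _ : Fin n => p).real
      {x | B < |blockMean J x i - μ|} ≤ ε / 4) :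
    (Measure.pi fun _ : Fin n => p).real
      {x | ε * k ≤ (farEntries (blockMean J x) μ B).card} ≤ Real.exp (-ε ^ 2 * k) := by
  classical
  set Q := Measure.pi fun _ : Fin n => p
  let E (i : Fin k) : Set (Fin n → ℝ) := {x | B < |blockMean J x i - μ|}
  have hE : ∀ i, MeasurableSet (E i) := fun i =>
    measurableSet_lt measurable_const ((measurable_blockMean J i).sub_const μ).abs
  let Z (i : Fin k) : (Fin n → ℝ) → ℝ := (E i).indicator 1
  have hZm : ∀ i, Measurable (Z i) := fun i => measurable_one.indicator (hE i)
  have hZE : ∀ i, ∫ x, Z i x ∂Q = Q.real (E i) := fun i => integral_indicator_one (hE i)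
  have hdep : ∀ i, DependsOn (Z i) (J.1 i : Set (Fin n)) := by
    intro i x y hxy
    have : blockMean J x i = blockMean J y i := by
      unfold blockMean
      rw [Finset.sum_congr rfl fun j hj => hxy j hj]
    simp only [Z, E, Set.indicator_apply, Set.mem_ofPred_eq, this, Pi.one_apply]
  -- Hoeffding's lemma: a centred [0,1]-valued variable is sub-Gaussian with parameter 1/4.
  have hsub : ∀ i, HasSubgaussianMGF (fun x => Z i x - ∫ x, Z i x ∂Q) ((‖(1 : ℝ) - 0‖₊ / 2) ^ 2)
      Q := fun i => hasSubgaussianMGF_of_mem_Icc (hZm i).aemeasurable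
        (Filter.Eventually.of_forall fun x => by
          simp only [Z, Set.indicator_apply]; split_ifs <;> simp)
  have hsum : ∀ t : Finset (Fin k), HasSubgaussianMGF
      (fun x => ∑ i ∈ t, (Z i x - ∫ x, Z i x ∂Q)) (t.card * (‖(1 : ℝ) - 0‖₊ / 2) ^ 2) Q := by
    intro t
    induction t using Finset.induction_on with
    | empty => simp
    | insert i t hi ih =>
      have hind : IndepFun (fun x => Z i x - ∫ x, Z i x ∂Q)
          (fun x => ∑ j ∈ t, (Z j x - ∫ x, Z j x ∂Q)) Q := by
        refine indepFun_of_dependsOn (S := J.1 i) (T := t.biUnion J.1) ((hZm i).sub_const _)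
          (Finset.measurable_fun_sum _ fun j _ => (hZm j).sub_const _) ?_ ?_ ?_
        · rw [Finset.disjoint_biUnion_right]
          exact fun j hj => J.2.2 fun h => hi (h ▸ hj)
        · intro x y hxy
          simp only [hdep i hxy]
        · intro x y hxy
          refine Finset.sum_congr rfl fun j hj => ?_
          rw [hdep j fun l hl => hxy l (Finset.mem_coe.2 (Finset.mem_biUnion.2 ⟨j, hj, hl⟩))]
      have h := (hsub i).add_of_indepFun ih hind
      simp_rw [Finset.sum_insert hi]
      rw [Finset.card_insert_of_notMem hi]
      convert h using 1
      push_cast; ring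
  have hk' : (0 : ℝ) < k := by exact_mod_cast hk
  -- The mean count is at most εk/4, so reaching εk is a deviation of 3εk/4. The exponent is then
  -- -(9/8)ε²k, slightly better than needed.
  have h := (hsum Finset.univ).measure_ge_le (ε := 3 / 4 * ε * k) (by positivity)
  refine (measureReal_mono fun x hx => ?_).trans (h.trans ?_)
  · simp only [Set.mem_ofPred_eq] at hx ⊢
    rw [Finset.sum_sub_distrib]
    have h1 : ∑ i, Z i x = (farEntries (blockMean J x) μ B).card := by
      simp [farEntries, Z, E, Set.indicator_apply, Finset.sum_boole]
    have h2 : ∑ i, ∫ x, Z i x ∂Q ≤ k * (ε / 4) := by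
      have := Finset.sum_le_card_nsmul Finset.univ (fun i => ∫ x, Z i x ∂Q) (ε / 4)
        fun i _ => by rw [hZE]; exact hq i
      simpa using this
    rw [h1]
    nlinarith
  · apply Real.exp_le_exp.2
    simp only [Finset.card_univ, Fintype.card_fin, sub_zero, nnnorm_one, NNReal.coe_mul,
      NNReal.coe_natCast, NNReal.coe_pow, NNReal.coe_div, NNReal.coe_one, NNReal.coe_ofNat]
    rw [div_le_iff₀ (by positivity)]
    have : 0 < ε ^ 2 * k ^ 2 := by positivity
    nlinarith

end Concentration

/-! ### Tail of a single clean block mean -/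

lemma memLp_id_of_finiteMoment {r : ℝ} (hr0 : 0 < r) {p : Measure ℝ}
    (hp : FiniteMoment (1 + r) p) : MemLp (fun x : ℝ => x) (ENNReal.ofReal (1 + r)) p :=
  (integrable_abs_rpow_iff_memLp (X := fun x : ℝ => x) hr0
    measurable_id.aestronglyMeasurable).1 hp.integrable

lemma centralMoment_nonneg (r : ℝ) (p : Measure ℝ) : 0 ≤ centralMoment r p :=
  integral_nonneg fun _ => Real.rpow_nonneg (abs_nonneg _) _

/-- Markov's inequality for a single block mean of a clean sample. -/
lemma measureReal_blockMean_far_le {r : ℝ} (hr0 : 0 < r) (hr1 : r ≤ 1) {p : Measure ℝ}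
    (hp : FiniteMoment (1 + r) p) {n k m : ℕ} (hm : 0 < m) (J : Blocks n k m) (i : Fin k)
    {B η : ℝ} (hB : 0 ≤ B) (hη : 0 ≤ η)
    (h : 4 * (m * centralMoment r p) ≤ η * (B * m) ^ (1 + r)) :
    (Measure.pi fun _ : Fin n => p).real {x | B < |blockMean J x i - mean p|} ≤ η := by
  have := hp.isProbabilityMeasure
  set Q := Measure.pi fun _ : Fin n => p
  have hm' : (0 : ℝ) < m := by exact_mod_cast hm
  have hr : 0 < 1 + r := by linarith
  let Y (j : Fin n) (x : Fin n → ℝ) : ℝ := x j - mean p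
  have hYm : ∀ j, Measurable (Y j) := fun j => (measurable_pi_apply j).sub_const _
  have hYind : iIndepFun Y Q :=
    iIndepFun_pi (X := fun _ x => x - mean p) fun _ => (measurable_id.sub_const _).aemeasurable
  have hpL := memLp_id_of_finiteMoment hr0 hp
  have hpI : Integrable (fun x : ℝ => x) p := hpL.integrable (by
    rw [← ENNReal.ofReal_one]; exact ENNReal.ofReal_le_ofReal (by linarith))
  have hev : ∀ j, MeasurePreserving (Function.eval j) Q p := fun j =>
    measurePreserving_eval (fun _ : Fin n => p) j
  have hYL : ∀ j, MemLp (Y j) (ENNReal.ofReal (1 + r)) Q := fun j =>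
    (hpL.sub (memLp_const (mean p))).comp_measurePreserving (hev j)
  have hint : ∀ (j : Fin n) (f : ℝ → ℝ), Measurable f → ∫ x, f (x j) ∂Q = ∫ t, f t ∂p := by
    intro j f hf
    rw [← (hev j).map_eq, integral_map (hev j).aemeasurable hf.aestronglyMeasurable]
  have hY0 : ∀ j, ∫ x, Y j x ∂Q = 0 := fun j => by
    rw [hint j (fun t => t - mean p) (by fun_prop), integral_sub hpI (integrable_const _)]
    simp [mean]
  have hYv : ∀ j, ∫ x, |Y j x| ^ (1 + r) ∂Q = centralMoment r p := fun j =>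
    hint j (fun t => |t - mean p| ^ (1 + r)) (by fun_prop)
  have hvBE := integral_abs_sum_rpow_le hr0 hr1 hYm hYind hYL hY0 (J.1 i)
  simp_rw [hYv] at hvBE
  rw [Finset.sum_const, J.2.1 i, nsmul_eq_mul] at hvBE
  let T (x : Fin n → ℝ) : ℝ := ∑ j ∈ J.1 i, Y j x
  have hTL : MemLp T (ENNReal.ofReal (1 + r)) Q := memLp_finsetSum _ fun j _ => hYL j
  have hTm : Measurable T := Finset.measurable_fun_sum _ fun j _ => hYm j
  have hTI := (integrable_abs_rpow_iff_memLp hr0 hTm.aestronglyMeasurable).2 hTL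
  have hTmean : ∀ x, blockMean J x i - mean p = T x / m := fun x => by
    simp only [blockMean, T, Y, Finset.sum_sub_distrib, Finset.sum_const, J.2.1 i, nsmul_eq_mul]
    field_simp
  have hset : {x | B < |blockMean J x i - mean p|} = {x | B * m < |T x|} := by
    ext x
    simp only [Set.mem_ofPred_eq, hTmean, abs_div, abs_of_pos hm']
    rw [lt_div_iff₀ hm']
  rw [hset]
  have hT : ∫ x, |T x| ^ (1 + r) ∂Q ≤ η * (B * m) ^ (1 + r) := hvBE.trans h
  rcases hB.eq_or_lt with rfl | hB
  -- For B = 0 Markov's inequality is void, but the moment of T is then zero, so T = 0 almost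
  -- everywhere.
  · rw [zero_mul, Real.zero_rpow hr.ne', mul_zero] at hT
    have h0 := (integral_eq_zero_iff_of_nonneg
      (fun x => Real.rpow_nonneg (abs_nonneg (T x)) (1 + r)) hTI).1
      (le_antisymm hT (integral_nonneg fun x => Real.rpow_nonneg (abs_nonneg _) _))
    have h1 : Q {x | 0 * (m : ℝ) < |T x|} = 0 := by
      refine measure_mono_null (fun x hx => ?_) (ae_iff.1 h0)
      simp only [Set.mem_ofPred_eq, zero_mul, Pi.zero_apply] at hx ⊢
      exact (Real.rpow_pos_of_pos hx _).ne'
    rw [measureReal_def, h1]; simpa using hη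
  · have hpos : 0 < (B * m) ^ (1 + r) := Real.rpow_pos_of_pos (by positivity) _
    have hM := mul_meas_ge_le_integral_of_nonneg
      (Filter.Eventually.of_forall fun x => Real.rpow_nonneg (abs_nonneg (T x)) (1 + r)) hTI
      ((B * m) ^ (1 + r))
    have hmono : Q.real {x | B * m < |T x|} ≤ Q.real {x | (B * m) ^ (1 + r) ≤ |T x| ^ (1 + r)} :=
      measureReal_mono fun x hx => Real.rpow_le_rpow (by positivity) (le_of_lt hx) hr.le
    refine hmono.trans (le_of_mul_le_mul_left ?_ hpos)
    linarith

/-! ### Passage to random blocks and contaminated samples -/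

/-- A bound on the number of far blocks that holds for every fixed family of blocks of a clean
sample passes to random blocks of a contaminated sample. -/
lemma IsExperiment.measureReal_half_le_card_farEntries_le {Ω : Type*} [MeasurableSpace Ω]
    {P : Measure Ω} [IsProbabilityMeasure P] {p : Measure ℝ} [IsProbabilityMeasure p] {α : ℝ}
    {n k : ℕ} {Xs X : Fin n → Ω → ℝ} {I : Ω → Blocks n k (n / k)}
    (h : IsExperiment P p α Xs X I) {μ B θ η : ℝ} (hη : 0 ≤ η) (hθ : θ + α * n ≤ k / 2)
    (hQ : ∀ J : Blocks n k (n / k), (Measure.pi fun _ : Fin n => p).real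
      {x | θ ≤ (farEntries (blockMean J x) μ B).card} ≤ η) :
    P.real {ω | (k : ℝ) / 2 ≤ (farEntries (blockMean (I ω) fun i => X i ω) μ B).card} ≤ η := by
  classical
  let Y (ω : Ω) : Fin n → ℝ := fun i => X i ω
  let Ys (ω : Ω) : Fin n → ℝ := fun i => Xs i ω
  have hYm : AEMeasurable Y P := aemeasurable_pi_lambda _ h.aemeasurable
  have hYsm : AEMeasurable Ys P := aemeasurable_pi_lambda _ fun i => (h.law i).aemeasurable
  have hlaw : P.map Ys = Measure.pi fun _ : Fin n => p := by
    rw [h.indep.map_fun_eq_pi_map fun i => (h.law i).aemeasurable]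
    simp_rw [fun i => (h.law i).map_eq]
  let G (J : Blocks n k (n / k)) (t : ℝ) : Set (Fin n → ℝ) :=
    {x | t ≤ (farEntries (blockMean J x) μ B).card}
  have hG : ∀ J t, MeasurableSet (G J t) := fun J t =>
    measurableSet_le measurable_const (measurable_card_farEntries J μ B)
  set N : ENNReal := (Fintype.card (Blocks n k (n / k)) : ENNReal) with hN
  have hI : ∀ J, P (I ⁻¹' {J}) = N⁻¹ := fun J => by
    rw [← Measure.map_apply_of_aemeasurable h.blocks_law.aemeasurable (MeasurableSet.of_discrete),
      h.blocks_law.map_eq, uniformOn_univ, Measure.count_singleton, one_div]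
  have hNtop : N ≠ ⊤ := ENNReal.natCast_ne_top _
  have hN0 : N ≠ 0 := by
    intro h0
    have : IsEmpty (Blocks n k (n / k)) := by
      rw [← Fintype.card_eq_zero_iff]; exact Nat.cast_eq_zero.1 h0
    obtain ⟨ω⟩ := nonempty_of_isProbabilityMeasure P
    exact this.false (I ω)
  have hclean : ∀ J, P (Ys ⁻¹' G J θ) ≤ ENNReal.ofReal η := fun J => by
    rw [← Measure.map_apply_of_aemeasurable hYsm (hG J θ), hlaw]
    exact (ENNReal.le_ofReal_iff_toReal_le (measure_ne_top _ _) hη).2 (hQ J)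
  -- The permutation depends on ω, so no comparison is available for a single J. Summed over all J
  -- inside the integral, it merely reindexes the families of blocks.
  have hsum : ∑ J, P (Y ⁻¹' G J (k / 2)) ≤ N * ENNReal.ofReal η := by
    calc ∑ J, P (Y ⁻¹' G J (k / 2))
        = ∫⁻ ω, ∑ J, (Y ⁻¹' G J (k / 2)).indicator 1 ω ∂P := by
          rw [lintegral_finsetSum' _ fun J _ => AEMeasurable.indicator₀ (f := 1)
            aemeasurable_one (hYm.nullMeasurable (hG J _))]
          exact Finset.sum_congr rfl fun J _ =>
            (lintegral_indicator_one₀ (hYm.nullMeasurable (hG J _))).symm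
      _ ≤ ∫⁻ ω, ∑ J, (Ys ⁻¹' G J θ).indicator 1 ω ∂P := by
          refine lintegral_mono_ae ?_
          filter_upwards [h.contamination] with ω hω
          obtain ⟨τ, hτ⟩ := hω.exists_perm
          have hbij : Function.Bijective (Blocks.perm τ : Blocks n k (n / k) → _) :=
            (Finite.injective_iff_bijective).1 (Blocks.perm_injective τ)
          rw [← hbij.sum_comp fun J => (Ys ⁻¹' G J θ).indicator 1 ω]
          refine Finset.sum_le_sum fun J _ => ?_
          by_cases hJ : ω ∈ Y ⁻¹' G J (k / 2)
          · have h1 : (k : ℝ) / 2 ≤ (farEntries (blockMean J (Y ω)) μ B).card := hJ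
            have h2 : ((farEntries (blockMean J (Y ω)) μ B).card : ℝ) ≤
              (farEntries (blockMean (J.perm τ) (Ys ω)) μ B).card + α * n := hτ k (n / k) J μ B
            have h3 : ω ∈ Ys ⁻¹' G (J.perm τ) θ := by
              change θ ≤ (farEntries (blockMean (J.perm τ) (Ys ω)) μ B).card
              linarith
            rw [Set.indicator_of_mem hJ, Set.indicator_of_mem h3]
          · rw [Set.indicator_of_notMem hJ]
            exact zero_le
      _ = ∑ J, P (Ys ⁻¹' G J θ) := by
          rw [lintegral_finsetSum' _ fun J _ => AEMeasurable.indicator₀ (f := 1)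
            aemeasurable_one (hYsm.nullMeasurable (hG J _))]
          exact Finset.sum_congr rfl fun J _ =>
            lintegral_indicator_one₀ (hYsm.nullMeasurable (hG J _))
      _ ≤ ∑ _J : Blocks n k (n / k), ENNReal.ofReal η := Finset.sum_le_sum fun J _ => hclean J
      _ = N * ENNReal.ofReal η := by simp [hN]
  have hmain : P {ω | (k : ℝ) / 2 ≤ (farEntries (blockMean (I ω) (Y ω)) μ B).card} ≤
      ENNReal.ofReal η := by
    -- Splitting over the value of I and using independence turns the probability into the average
    -- over J of the fixed-block probabilities.
    calc P {ω | (k : ℝ) / 2 ≤ (farEntries (blockMean (I ω) (Y ω)) μ B).card}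
        ≤ P (⋃ J ∈ (Finset.univ : Finset (Blocks n k (n / k))),
            Y ⁻¹' G J (k / 2) ∩ I ⁻¹' {J}) := by
          refine measure_mono fun ω hω => ?_
          simp only [Set.mem_iUnion]
          exact ⟨I ω, Finset.mem_univ _, hω, rfl⟩
      _ ≤ ∑ J, P (Y ⁻¹' G J (k / 2) ∩ I ⁻¹' {J}) := measure_biUnion_finset_le _ _
      _ = ∑ J, P (Y ⁻¹' G J (k / 2)) * N⁻¹ := by
          refine Finset.sum_congr rfl fun J _ => ?_
          rw [← hI J]
          exact h.blocks_indep.measure_inter_preimage_eq_mul (Prod.snd ⁻¹' G J (k / 2)) {J}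
            (measurable_snd (hG J _)) MeasurableSet.of_discrete
      _ = (∑ J, P (Y ⁻¹' G J (k / 2))) * N⁻¹ := by rw [Finset.sum_mul]
      _ ≤ N * ENNReal.ofReal η * N⁻¹ := by gcongr
      _ = ENNReal.ofReal η := by
          rw [mul_comm, ← mul_assoc, ENNReal.inv_mul_cancel hN0 hNtop, one_mul]
  exact ENNReal.toReal_le_of_le_ofReal hη hmain

/-! ### Calibration of constants and the upper bound -/

/-- The number of blocks is at most proportional to `n` times the squared error rate. -/
lemma numBlocks_le {γ δ α : ℝ} {n : ℕ} (hγ : 2 < γ) (hγ' : γ ≤ 2.5) (hδ : 0 < δ) (hδ1 : δ < 1)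
    (hα : 0 ≤ α) :
    (numBlocks γ δ α n : ℝ) ≤
      5 / 2 * (Real.log (2 / δ) + α * n) / (1 / 2 - 1 / γ) ^ 2 := by
  set ε := 1 / 2 - 1 / γ with hε
  have hε0 : 0 < ε := sub_pos.2 (one_div_lt_one_div_of_lt (by norm_num) hγ)
  have hε1 : ε ≤ 1 / 10 := by
    have : 1 / 2.5 ≤ 1 / γ := one_div_le_one_div_of_le (by linarith) hγ'
    norm_num at this
    rw [hε, one_div γ]
    linarith
  set L := Real.log (2 / δ)
  -- With ε² ≤ 1/100, this lower bound absorbs the +1 of the ceilings; the factor 5/2 is the bound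
  -- on γ.
  have hL : 1 / 2 ≤ L := by
    have h1 : Real.log 2 ≤ L := Real.log_le_log (by norm_num) (by
      rw [le_div_iff₀ hδ]; linarith)
    linarith [Real.log_two_gt_d9]
  have hε2 : 0 < ε ^ 2 := by positivity
  have hε3 : ε ^ 2 ≤ 1 / 100 := by nlinarith
  have hn : (0 : ℝ) ≤ n := Nat.cast_nonneg n
  have hαn : 0 ≤ α * n := by positivity
  rw [le_div_iff₀ hε2]
  have h1 : (⌈L / ε ^ 2⌉₊ : ℝ) * ε ^ 2 ≤ 5 / 2 * (L + α * n) := by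
    have := (Nat.ceil_lt_add_one (by positivity : 0 ≤ L / ε ^ 2)).le
    have h2 := mul_le_mul_of_nonneg_right this hε2.le
    rw [add_mul, div_mul_cancel₀ _ hε2.ne'] at h2
    linarith
  have h2 : (⌈γ * α * n⌉₊ : ℝ) * ε ^ 2 ≤ 5 / 2 * (L + α * n) := by
    have h0 : 0 ≤ γ * α * n := by positivity
    have := (Nat.ceil_lt_add_one h0).le
    have h2 := mul_le_mul_of_nonneg_right this hε2.le
    have h3 : γ * α * n ≤ 5 / 2 * (α * n) := by rw [mul_assoc]; norm_num at hγ'; gcongr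
    nlinarith
  have hcast : (numBlocks γ δ α n : ℝ) = max (⌈L / ε ^ 2⌉₊ : ℝ) (⌈γ * α * n⌉₊ : ℝ) := by
    rw [numBlocks, Nat.cast_max]
  rw [hcast]
  rcases max_choice (⌈L / ε ^ 2⌉₊ : ℝ) (⌈γ * α * n⌉₊ : ℝ) with h | h <;> rw [h]
  · exact h1
  · exact h2

/-- The error rate suffices for Markov's inequality on blocks of `m` samples. -/
lemma moment_le_rate_rpow {r ε v a b m : ℝ} (hr0 : 0 < r) (hr1 : r ≤ 1) (hε : 0 < ε)
    (hv : 0 ≤ v) (ha : 0 ≤ a) (hb : 0 ≤ b) (hm : 0 < m) (h : 1 ≤ 5 * (a + b) / ε ^ 2 * m) :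
    4 * (m * v) ≤ ε / 4 * ((80 * ε ^ (-((2 * r + 1) / (1 + r))) *
      (v ^ (1 / (1 + r)) * (a ^ (r / (1 + r)) + b ^ (r / (1 + r))))) * m) ^ (1 + r) := by
  have hr : 0 < 1 + r := by linarith
  have has := Real.rpow_nonneg ha (r / (1 + r))
  have hbs := Real.rpow_nonneg hb (r / (1 + r))
  have hvs := Real.rpow_nonneg hv (1 / (1 + r))
  have hεs := Real.rpow_nonneg hε.le (-((2 * r + 1) / (1 + r)))
  rw [Real.mul_rpow (by positivity) hm.le, Real.mul_rpow (by positivity) (by positivity),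
    Real.mul_rpow (by positivity) hεs, Real.mul_rpow hvs (by positivity), ← Real.rpow_mul hε.le,
    ← Real.rpow_mul hv, one_div_mul_cancel hr.ne', Real.rpow_one, neg_mul,
    div_mul_cancel₀ _ hr.ne']
  have h80 : (80 : ℝ) ≤ 80 ^ (1 + r) := by
    simpa using Real.rpow_le_rpow_of_exponent_le (by norm_num : (1 : ℝ) ≤ 80)
      (by linarith : 1 ≤ 1 + r)
  have hab : (a + b) ^ r ≤ (a ^ (r / (1 + r)) + b ^ (r / (1 + r))) ^ (1 + r) := by
    have h1 := Real.rpow_add_le_add_rpow ha hb (by positivity : 0 ≤ r / (1 + r))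
      (by rw [div_le_one hr]; linarith)
    have h2 := Real.rpow_le_rpow (by positivity) h1 hr.le
    rwa [← Real.rpow_mul (by positivity), div_mul_cancel₀ _ hr.ne'] at h2
  -- Origin of the exponent of C(γ): its (1+r)-th power must supply ε⁻¹ to cancel the tail level
  -- ε/4, and ε^(-2r) because the block size is of order at least ε²/(a + b).
  have hsplit : ε ^ (-(2 * r + 1)) = ε⁻¹ * ((ε ^ 2)⁻¹) ^ r := by
    rw [Real.inv_rpow (by positivity), ← Real.rpow_natCast, ← Real.rpow_mul hε.le, neg_add,
      Real.rpow_add hε, Real.rpow_neg_one, Real.rpow_neg hε.le, mul_comm]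
    norm_num
  have hmr : m ^ (1 + r) = m * m ^ r := by rw [Real.rpow_add hm, Real.rpow_one]
  have hone : 1 ≤ 5 * (((ε ^ 2)⁻¹) ^ r * (a + b) ^ r * m ^ r) := by
    rw [← Real.mul_rpow (by positivity) (by positivity), ← Real.mul_rpow (by positivity) hm.le]
    have h1 : 1 ≤ (5 * ((ε ^ 2)⁻¹ * (a + b) * m)) ^ r :=
      Real.one_le_rpow (by convert h using 1; field_simp) hr0.le
    rw [Real.mul_rpow (by norm_num) (by positivity)] at h1
    have h5 : (5 : ℝ) ^ r ≤ 5 := by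
      simpa using Real.rpow_le_rpow_of_exponent_le (by norm_num : (1 : ℝ) ≤ 5) hr1
    refine h1.trans ?_
    gcongr
  rw [hsplit, hmr]
  have hW := Real.rpow_nonneg (add_nonneg has hbs) (1 + r)
  have hE : 0 ≤ ((ε ^ 2)⁻¹) ^ r := by positivity
  have hM : 0 ≤ m ^ r := by positivity
  -- The constant 80 is 4 (von Bahr–Esseen) times 5 (from `hone`) times 4 (from ε/4).
  calc 4 * (m * v) ≤ 4 * (m * v) * (5 * (((ε ^ 2)⁻¹) ^ r * (a + b) ^ r * m ^ r)) :=
        le_mul_of_one_le_right (by positivity) hone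
    _ = ε / 4 * (80 * (ε⁻¹ * ((ε ^ 2)⁻¹) ^ r) * (v * (a + b) ^ r) * (m * m ^ r)) := by
        field_simp; ring
    _ ≤ _ := by gcongr

/-- The error bound for the median-of-means estimator. -/
theorem IsExperiment.one_sub_le_measureReal {r : ℝ} (hr0 : 0 < r) (hr1 : r ≤ 1) {γ : ℝ}
    (hγ : 2 < γ) (hγ' : γ ≤ 2.5) {n : ℕ} {δ : ℝ}
    (hδ : 2 * Real.exp (-(1 / 2 - 1 / γ) ^ 2 * n) < δ) {p : Measure ℝ}
    (hp : FiniteMoment (1 + r) p) {α : ℝ} (hα : 0 ≤ α) (hα' : α ≤ 0.4)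
    {Ω : Type*} [MeasurableSpace Ω] {P : Measure Ω} [IsProbabilityMeasure P]
    {Xs X : Fin n → Ω → ℝ} {k : ℕ} (hk : k = numBlocks γ δ α n) {I : Ω → Blocks n k (n / k)}
    (h : IsExperiment P p α Xs X I) :
    1 - δ ≤ P.real {ω | |estimator (I ω) (fun i => X i ω) - mean p| ≤
      80 * (1 / 2 - 1 / γ) ^ (-((2 * r + 1) / (1 + r))) *
        rate r (centralMoment r p) n δ α} := by
  have := hp.isProbabilityMeasure
  have hδ0 : 0 < δ := lt_trans (by positivity) hδ
  rcases le_or_gt 1 δ with hδ1 | hδ1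
  · exact (sub_nonpos.2 hδ1).trans measureReal_nonneg
  have hkle := numBlocks_le (n := n) hγ hγ' hδ0 hδ1 hα
  rw [← hk] at hkle
  set ε := 1 / 2 - 1 / γ with hε
  have hε0 : 0 < ε := sub_pos.2 (one_div_lt_one_div_of_lt (by norm_num) hγ)
  set L := Real.log (2 / δ) with hLdef
  have hL0 : 0 < L := Real.log_pos (by rw [lt_div_iff₀ hδ0]; linarith)
  have hexpL : Real.exp (-L) = δ / 2 := by
    rw [Real.exp_neg, hLdef, Real.exp_log (by positivity), inv_div]
  have hLn : L < ε ^ 2 * n := by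
    have : Real.exp (-(ε ^ 2 * n)) < Real.exp (-L) := by
      rw [hexpL]; rw [neg_mul] at hδ; linarith
    linarith [Real.exp_lt_exp.1 this]
  have hn : 0 < n := Nat.pos_of_ne_zero fun h0 => by
    rw [h0] at hLn; simp only [Nat.cast_zero, mul_zero] at hLn; linarith
  have hn' : (0 : ℝ) < n := by exact_mod_cast hn
  have hkL : L / ε ^ 2 ≤ k := hk ▸ (Nat.le_ceil _).trans (by exact_mod_cast le_max_left _ _)
  have hkα : γ * α * n ≤ k := hk ▸ (Nat.le_ceil _).trans (by exact_mod_cast le_max_right _ _)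
  have hk0' : (0 : ℝ) < k := lt_of_lt_of_le (by positivity) hkL
  have hk0 : 0 < k := by exact_mod_cast hk0'
  -- Blocks are non-empty: the first term of the maximum is controlled by the lower bound on δ, the
  -- second by γα ≤ 2.5 · 0.4 = 1.
  have hkn : k ≤ n := by
    rw [hk]
    refine max_le (Nat.ceil_le.2 ?_) (Nat.ceil_le.2 ?_)
    · rw [div_le_iff₀ (pow_pos hε0 2), mul_comm]; exact hLn.le
    · norm_num at hγ' hα'
      have : γ * α ≤ 1 := by nlinarith
      nlinarith
  have hm0 : 0 < n / k := Nat.div_pos hkn hk0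
  have hm0' : (0 : ℝ) < (n / k : ℕ) := by exact_mod_cast hm0
  have hnk : (n : ℝ) ≤ 2 * (k * (n / k : ℕ)) := by
    have h1 := Nat.div_add_mod n k
    have h2 := Nat.mod_lt n hk0
    have h3 : k ≤ k * (n / k) := Nat.le_mul_of_pos_right _ hm0
    have : n ≤ 2 * (k * (n / k)) := by omega
    exact_mod_cast this
  set B := 80 * ε ^ (-((2 * r + 1) / (1 + r))) * rate r (centralMoment r p) n δ α with hBdef
  have hv := centralMoment_nonneg r p
  have hB : 0 ≤ B := by
    have : 0 ≤ rate r (centralMoment r p) n δ α :=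
      mul_nonneg (Real.rpow_nonneg hv _) (add_nonneg (Real.rpow_nonneg (by positivity) _)
        (Real.rpow_nonneg hα _))
    positivity
  have hmoment : 4 * ((n / k : ℕ) * centralMoment r p) ≤
      ε / 4 * (B * (n / k : ℕ)) ^ (1 + r) := by
    refine moment_le_rate_rpow hr0 hr1 hε0 hv (by positivity) hα hm0' ?_
    have h1 : (n : ℝ) ≤ 2 * (5 / 2 * (L + α * n) / ε ^ 2 * (n / k : ℕ)) := hnk.trans (by gcongr)
    have h2 : 5 * (L / n + α) / ε ^ 2 * (n / k : ℕ) =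
        2 * (5 / 2 * (L + α * n) / ε ^ 2 * (n / k : ℕ)) / n := by field_simp
    rw [h2, le_div_iff₀ hn', one_mul]
    exact h1
  -- The threshold εk is exactly what remains of k/2 after giving up k/γ blocks to the adversary.
  have hbad := h.measureReal_half_le_card_farEntries_le (μ := mean p) (B := B) (θ := ε * k)
    (η := δ / 2) (by linarith) (by
      have h1 : α * n ≤ k / γ := by rw [le_div_iff₀ (by linarith)]; linarith
      have h2 : ε * k = k / 2 - k / γ := by rw [hε]; ring
      linarith) fun J => by
    refine (measureReal_le_card_farEntries_le hk0 J hε0 fun i =>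
      measureReal_blockMean_far_le hr0 hr1 hp hm0 J i hB (by positivity) hmoment).trans ?_
    rw [← hexpL]
    refine Real.exp_le_exp.2 ?_
    rw [div_le_iff₀ (by positivity)] at hkL
    linarith
  set good := {ω | |estimator (I ω) (fun i => X i ω) - mean p| ≤ B}
  set bad := {ω | (k : ℝ) / 2 ≤ (farEntries (blockMean (I ω) fun i => X i ω) (mean p) B).card}
  have hcover : good ∪ bad = Set.univ := by
    refine Set.eq_univ_of_forall fun ω => ?_
    by_cases hω : |estimator (I ω) (fun i => X i ω) - mean p| ≤ B
    · exact Or.inl hω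
    · exact Or.inr (half_le_card_farEntries hk0 _ (not_le.1 hω))
  have h1 := measureReal_union_le (μ := P) good bad
  rw [hcover, probReal_univ] at h1
  linarith

/-! ### Two-point distributions -/

/-- The distribution with mass `q` at `a` and mass `1 - q` at `0`. -/
noncomputable def twoPoint (q a : ℝ) : Measure ℝ :=
  ENNReal.ofReal (1 - q) • Measure.dirac 0 + ENNReal.ofReal q • Measure.dirac a

section TwoPoint

variable {q a : ℝ}

lemma isProbabilityMeasure_twoPoint (h0 : 0 ≤ q) (h1 : q ≤ 1) :
    IsProbabilityMeasure (twoPoint q a) := by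
  refine ⟨?_⟩
  simp only [twoPoint, Measure.coe_add, Measure.coe_smul, Pi.add_apply, Pi.smul_apply,
    measure_univ, smul_eq_mul, mul_one]
  rw [← ENNReal.ofReal_add (by linarith) h0]
  simp

lemma integrable_twoPoint (f : ℝ → ℝ) : Integrable f (twoPoint q a) :=
  ((integrable_dirac (by simp)).smul_measure ENNReal.ofReal_ne_top).add_measure
    ((integrable_dirac (by simp)).smul_measure ENNReal.ofReal_ne_top)

lemma integral_twoPoint (h0 : 0 ≤ q) (h1 : q ≤ 1) (f : ℝ → ℝ) :
    ∫ x, f x ∂twoPoint q a = (1 - q) * f 0 + q * f a := by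
  rw [twoPoint, integral_add_measure
    ((integrable_dirac (by simp)).smul_measure ENNReal.ofReal_ne_top)
    ((integrable_dirac (by simp)).smul_measure ENNReal.ofReal_ne_top),
    integral_smul_measure, integral_smul_measure, integral_dirac, integral_dirac,
    ENNReal.toReal_ofReal (by linarith), ENNReal.toReal_ofReal h0, smul_eq_mul, smul_eq_mul]

lemma finiteMoment_twoPoint (h0 : 0 ≤ q) (h1 : q ≤ 1) (s : ℝ) : FiniteMoment s (twoPoint q a) :=
  ⟨isProbabilityMeasure_twoPoint h0 h1, integrable_twoPoint _⟩

lemma mean_twoPoint (h0 : 0 ≤ q) (h1 : q ≤ 1) : mean (twoPoint q a) = q * a := by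
  rw [mean, integral_twoPoint h0 h1 fun x => x]; ring

lemma centralMoment_twoPoint (h0 : 0 ≤ q) (h1 : q ≤ 1) (r : ℝ) :
    centralMoment r (twoPoint q a) =
      |a| ^ (1 + r) * ((1 - q) * q ^ (1 + r) + q * (1 - q) ^ (1 + r)) := by
  rw [centralMoment, mean_twoPoint h0 h1, integral_twoPoint h0 h1 fun x => |x - q * a| ^ (1 + r),
    zero_sub, abs_neg, show a - q * a = (1 - q) * a by ring, abs_mul, abs_mul, abs_of_nonneg h0,
    abs_of_nonneg (sub_nonneg.2 h1), Real.mul_rpow h0 (abs_nonneg a),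
    Real.mul_rpow (sub_nonneg.2 h1) (abs_nonneg a)]
  ring

lemma twoPoint_singleton_zero (ha : a ≠ 0) : twoPoint q a {0} = ENNReal.ofReal (1 - q) := by
  simp [twoPoint, ha]

lemma twoPoint_real_compl_zero (h0 : 0 ≤ q) (ha : a ≠ 0) : (twoPoint q a).real {0}ᶜ = q := by
  simp [twoPoint, measureReal_def, ha, h0]

end TwoPoint

/-! ### The erasing attack -/

section Attack

variable {n : ℕ}

/-- The number of non-zero entries of a sample. -/
noncomputable def numNonzero (x : Fin n → ℝ) : ℝ := ∑ i, Set.indicator {0}ᶜ 1 (x i)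

lemma measurable_numNonzero : Measurable (numNonzero : (Fin n → ℝ) → ℝ) :=
  Finset.measurable_fun_sum _ fun i _ =>
    (measurable_one.indicator (measurableSet_singleton 0).compl).comp (measurable_pi_apply i)

open Classical in
/-- The attack that erases the non-zero entries of a sample whenever it can afford to. -/
noncomputable def eraseAttack (α : ℝ) (x : Fin n → ℝ) : Fin n → ℝ :=
  if numNonzero x ≤ α * n then 0 else x

lemma measurable_eraseAttack (α : ℝ) :
    Measurable (eraseAttack α : (Fin n → ℝ) → Fin n → ℝ) := by
  classical
  exact Measurable.ite (measurableSet_le measurable_numNonzero measurable_const)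
    measurable_const measurable_id

lemma isContamination_eraseAttack {α : ℝ} (hα : 0 ≤ α) (x : Fin n → ℝ) :
    IsContamination α x (eraseAttack α x) := by
  classical
  by_cases h : numNonzero x ≤ α * n
  · refine ⟨Finset.univ.filter fun i => x i = 0, id, ?_, Set.injOn_id _, fun i hi => ?_⟩
    · have hcard : ((Finset.univ.filter fun i => x i = 0).card : ℝ) + numNonzero x = n := by
        have h1 : numNonzero x = (Finset.univ.filter fun i => ¬ x i = 0).card := by
          simp [numNonzero, Set.indicator_apply, ← Finset.sum_boole]
        rw [h1]
        have := Finset.card_filter_add_card_filter_not (s := (Finset.univ : Finset (Fin n)))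
          (fun i => x i = 0)
        rw [Finset.card_univ, Fintype.card_fin] at this
        exact_mod_cast this
      linarith
    · simp only [Finset.mem_filter, Finset.mem_univ, true_and] at hi
      simp [eraseAttack, h, hi]
  · refine ⟨Finset.univ, id, ?_, Set.injOn_id _, fun i _ => by simp [eraseAttack, h]⟩
    have : (0 : ℝ) ≤ α * n := by positivity
    simp only [Finset.card_univ, Fintype.card_fin]
    linarith

/-- The small-q regime: the clean sample is already zero with probability (1-q)^n, and the attack
leaves it so. -/
lemma pow_le_measureReal_eraseAttack_eq_zero {q a α : ℝ} (h0 : 0 ≤ q) (h1 : q ≤ 1) (ha : a ≠ 0) :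
    (1 - q) ^ n ≤
      (Measure.pi fun _ : Fin n => twoPoint q a).real {x | eraseAttack α x = 0} := by
  have := isProbabilityMeasure_twoPoint (a := a) h0 h1
  have hz : (Measure.pi fun _ : Fin n => twoPoint q a).real {0} = (1 - q) ^ n := by
    rw [measureReal_def, Measure.pi_singleton]
    simp [twoPoint_singleton_zero ha, h1]
  rw [← hz]
  refine measureReal_mono fun x hx => ?_
  rw [Set.mem_singleton_iff.1 hx]
  simp [eraseAttack]

/-- At q = α/2 the expected number of non-zero entries is half the budget αn, so by Markov they can
be erased with probability at least 1/2. -/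
lemma half_le_measureReal_eraseAttack_eq_zero {a α : ℝ} (ha : a ≠ 0) (hα : 0 < α) (hα1 : α ≤ 1)
    (hn : 0 < n) : 1 / 2 ≤
      (Measure.pi fun _ : Fin n => twoPoint (α / 2) a).real {x | eraseAttack α x = 0} := by
  have hq0 : 0 ≤ α / 2 := by linarith
  have := isProbabilityMeasure_twoPoint (q := α / 2) (a := a) hq0 (by linarith)
  set Q := Measure.pi fun _ : Fin n => twoPoint (α / 2) a
  have hmp : ∀ i, MeasurePreserving (Function.eval i) Q (twoPoint (α / 2) a) := fun i =>
    measurePreserving_eval (fun _ : Fin n => twoPoint (α / 2) a) i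
  have hS : MeasurableSet ({0}ᶜ : Set ℝ) := (measurableSet_singleton 0).compl
  have hI : ∀ i : Fin n, Integrable (fun x : Fin n → ℝ => Set.indicator {0}ᶜ (1 : ℝ → ℝ) (x i)) Q :=
    fun i => (hmp i).integrable_comp_of_integrable
      (integrable_twoPoint (Set.indicator {0}ᶜ (1 : ℝ → ℝ)))
  have hint : ∀ i : Fin n, ∫ x, Set.indicator {0}ᶜ (1 : ℝ → ℝ) (x i) ∂Q = α / 2 := fun i => by
    have h := integral_map (hmp i).aemeasurable (f := Set.indicator {0}ᶜ (1 : ℝ → ℝ))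
      (measurable_one.indicator hS).aestronglyMeasurable
    rw [(hmp i).map_eq, integral_indicator_one hS, twoPoint_real_compl_zero hq0 ha] at h
    exact h.symm
  have hE : ∫ x, numNonzero x ∂Q = n * (α / 2) := by
    unfold numNonzero
    rw [integral_finsetSum _ fun i _ => hI i]
    simp [hint]
  have hM := mul_meas_ge_le_integral_of_nonneg (μ := Q) (f := numNonzero)
    (Filter.Eventually.of_forall fun x => Finset.sum_nonneg fun i _ =>
      Set.indicator_nonneg (fun _ _ => zero_le_one) _)
    (integrable_finsetSum _ fun i _ => hI i) (α * n)
  rw [hE] at hM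
  have hn' : (0 : ℝ) < n := by exact_mod_cast hn
  have hM' : Q.real {x | α * n ≤ numNonzero x} ≤ 1 / 2 := by
    refine le_of_mul_le_mul_left ?_ (by positivity : 0 < α * n)
    linarith
  have hcover : {x | eraseAttack α x = 0} ∪ {x : Fin n → ℝ | α * n ≤ numNonzero x} = Set.univ := by
    refine Set.eq_univ_of_forall fun x => ?_
    rcases le_total (numNonzero x) (α * n) with h | h
    · exact Or.inl (if_pos h)
    · exact Or.inr h
  have h1 := measureReal_union_le (μ := Q) {x | eraseAttack α x = 0}
    {x : Fin n → ℝ | α * n ≤ numNonzero x}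
  rw [hcover, probReal_univ] at h1
  linarith

end Attack

/-! ### Minimax lower bound -/

/-- Whenever the attack produces z, the estimate has law κ z whatever the clean sample was; keeping
only this event gives the bound. -/
lemma mul_measureReal_le_comp_map {α β : Type*} [MeasurableSpace α] [MeasurableSpace β]
    {Q : Measure α} [IsProbabilityMeasure Q] {κ : Kernel α β} [IsMarkovKernel κ] {A : α → α}
    (hA : Measurable A) (z : α) {s : Set β} (hs : MeasurableSet s) :
    (κ z).real s * Q.real {x | A x = z} ≤ (κ ∘ₘ Q.map A).real s := by
  have : IsProbabilityMeasure (Q.map A) := Measure.isProbabilityMeasure_map hA.aemeasurable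
  rw [measureReal_def, measureReal_def, measureReal_def, ← ENNReal.toReal_mul]
  refine ENNReal.toReal_mono (measure_ne_top _ _) ?_
  rw [Measure.bind_apply hs κ.aemeasurable, lintegral_map (κ.measurable_coe hs) hA]
  refine le_trans ?_ (mul_meas_ge_le_lintegral₀ ((κ.measurable_coe hs).comp hA).aemeasurable
    (κ z s))
  gcongr with x
  intro hx
  rw [Function.comp_apply, hx]

/-- The error rate is at most of the order of the mean `q a` of the two-point distribution with
central moment `v`. -/
lemma rate_le_mul_rpow {r v q L α w : ℝ} {n : ℕ} {δ : ℝ} (hr0 : 0 < r) (hv : 0 < v) (hq : 0 < q)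
    (hw0 : 0 < w) (hw : w ≤ 2 * q) (hL : Real.log (2 / δ) = L) (hL0 : 0 ≤ L)
    (hLq : L / n ≤ 6 * q) (hα : 0 ≤ α) (hαq : α ≤ 2 * q) :
    1 / 16 * rate r v n δ α ≤ q * (v / w) ^ (1 / (1 + r)) := by
  have hr : 0 < 1 + r := by linarith
  set s := r / (1 + r) with hs
  have hs0 : 0 ≤ s := by positivity
  have hs1 : s ≤ 1 := by rw [hs, div_le_one hr]; linarith
  have ht : 1 / (1 + r) = 1 - s := by rw [hs]; field_simp; ring
  rw [rate, hL, ht, ← hs, Real.div_rpow hv.le hw0.le]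
  have hqs := Real.rpow_pos_of_pos hq s
  have hvs := Real.rpow_pos_of_pos hv (1 - s)
  have hpow : ∀ c : ℝ, 1 ≤ c → c ^ s ≤ c := fun c hc => by
    simpa using Real.rpow_le_rpow_of_exponent_le hc hs1
  have h1 : (L / n) ^ s ≤ 6 * q ^ s := by
    refine (Real.rpow_le_rpow (by positivity) hLq hs0).trans ?_
    rw [Real.mul_rpow (by norm_num) hq.le]
    have := hpow 6 (by norm_num)
    gcongr
  have h2 : α ^ s ≤ 2 * q ^ s := by
    refine (Real.rpow_le_rpow hα hαq hs0).trans ?_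
    rw [Real.mul_rpow (by norm_num) hq.le]
    have := hpow 2 (by norm_num)
    gcongr
  have h3 : w ^ (1 - s) * q ^ s ≤ 2 * q := by
    have h4 : w ^ (1 - s) ≤ 2 * q ^ (1 - s) := by
      refine (Real.rpow_le_rpow hw0.le hw (by linarith)).trans ?_
      rw [Real.mul_rpow (by norm_num) hq.le]
      have : (2 : ℝ) ^ (1 - s) ≤ 2 := by
        simpa using Real.rpow_le_rpow_of_exponent_le (by norm_num : (1 : ℝ) ≤ 2)
          (by linarith : 1 - s ≤ 1)
      gcongr
    calc w ^ (1 - s) * q ^ s ≤ 2 * q ^ (1 - s) * q ^ s := by gcongr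
      _ = 2 * q := by rw [mul_assoc, ← Real.rpow_add hq]; simp
  have hws := Real.rpow_pos_of_pos hw0 (1 - s)
  have h5 : q ^ s / 2 ≤ q / w ^ (1 - s) := by
    rw [div_le_div_iff₀ (by norm_num) hws]; linarith
  -- Here 16 = 2(6 + 2): the 6 and 2 bound the two parts of the rate by q^s, and the other 2 comes
  -- from w ≤ 2q.
  calc 1 / 16 * (v ^ (1 - s) * ((L / n) ^ s + α ^ s))
      ≤ 1 / 16 * (v ^ (1 - s) * (6 * q ^ s + 2 * q ^ s)) := by gcongr
    _ = v ^ (1 - s) * (q ^ s / 2) := by ring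
    _ ≤ v ^ (1 - s) * (q / w ^ (1 - s)) := by gcongr
    _ = _ := by ring

/-- The minimax lower bound under contamination. -/
theorem exists_attack {r : ℝ} (hr0 : 0 < r) {n : ℕ} {δ : ℝ}
    (hδ : Real.exp (-n) ≤ δ) (hδ' : δ ≤ 1 / 4) {α : ℝ} (hα : 0 ≤ α) (hα' : α ≤ 0.4) {v : ℝ}
    (hv : 0 < v) (κ : Kernel (Fin n → ℝ) ℝ) [IsMarkovKernel κ] :
    ∃ p : Measure ℝ, FiniteMoment (1 + r) p ∧ centralMoment r p = v ∧
      ∃ A : (Fin n → ℝ) → (Fin n → ℝ), Measurable A ∧ (∀ xs, IsContamination α xs (A xs)) ∧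
        δ ≤ (κ ∘ₘ (Measure.pi fun _ => p).map A).real
          {t : ℝ | 1 / 16 * rate r v n δ α ≤ |t - mean p|} := by
  have hδ0 : 0 < δ := (Real.exp_pos _).trans_le hδ
  have hr : 0 < 1 + r := by linarith
  have hn : 0 < n := Nat.pos_of_ne_zero fun h0 => by
    rw [h0] at hδ; norm_num at hδ; linarith
  have hn' : (0 : ℝ) < n := by exact_mod_cast hn
  -- Chosen so that exp(-l) = 2δ: the factor 2 pays for the probability 1/2 with which the estimator
  -- fails on the zero sample.
  set l := Real.log (1 / (2 * δ)) with hl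
  have hlog2 := Real.log_two_gt_d9
  have hl2 : Real.log 2 ≤ l := Real.log_le_log (by norm_num) (by
    rw [le_div_iff₀ (by positivity)]; linarith)
  have hexpl : Real.exp (-l) = 2 * δ := by
    rw [Real.exp_neg, hl, Real.exp_log (by positivity), one_div, inv_inv]
  have hln : l ≤ n := by
    have : Real.exp (-(n : ℝ)) ≤ Real.exp (-l) := by rw [hexpl]; linarith
    linarith [Real.exp_le_exp.1 this]
  -- As δ ≤ 1/4 gives log 2 ≤ l, the right side is at most 3l ≤ 6nq.
  have hL : Real.log (2 / δ) = l + 2 * Real.log 2 := by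
    rw [hl, show 2 / δ = 1 / (2 * δ) * 2 ^ 2 by field_simp,
      Real.log_mul (by positivity) (by norm_num), Real.log_pow]
    norm_num
  set q := max (l / (2 * n)) (α / 2) with hq
  have hlq : l / (2 * n) ≤ q := le_max_left _ _
  have hαq : α / 2 ≤ q := le_max_right _ _
  have hq0 : 0 < q := lt_of_lt_of_le (div_pos (by linarith) (by positivity)) hlq
  have hq1 : q ≤ 1 / 2 := by
    refine max_le ?_ (by norm_num at hα'; linarith)
    rw [div_le_iff₀ (by positivity)]; linarith
  have hq1' : q ≤ 1 := by linarith
  set w := (1 - q) * q ^ (1 + r) + q * (1 - q) ^ (1 + r) with hw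
  have hw0 : 0 < w := by
    have : 0 < 1 - q := by linarith
    positivity
  have hw2 : w ≤ 2 * q := by
    have h1 : q ^ (1 + r) ≤ q := by
      simpa using Real.rpow_le_rpow_of_exponent_ge hq0 hq1' (by linarith : 1 ≤ 1 + r)
    have h2 : (1 - q) ^ (1 + r) ≤ 1 := Real.rpow_le_one (by linarith) (by linarith) hr.le
    have := Real.rpow_nonneg hq0.le (1 + r)
    nlinarith
  set a := (v / w) ^ (1 / (1 + r)) with ha
  have ha0 : 0 < a := Real.rpow_pos_of_pos (by positivity) _
  have hrate : 1 / 16 * rate r v n δ α ≤ q * a := by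
    refine rate_le_mul_rpow hr0 hv hq0 hw0 hw2 hL (by linarith) ?_ hα (by linarith)
    rw [div_le_iff₀ hn']
    rw [div_le_iff₀ (by positivity)] at hlq
    linarith
  have hmoment : ∀ b : ℝ, |b| = a → centralMoment r (twoPoint q b) = v := fun b hb => by
    rw [centralMoment_twoPoint hq0.le hq1', hb, ha, ← Real.rpow_mul (by positivity),
      one_div_mul_cancel hr.ne', Real.rpow_one, ← hw, div_mul_cancel₀ _ hw0.ne']
  have hattack : ∀ b : ℝ, b ≠ 0 → 2 * δ ≤
      (Measure.pi fun _ : Fin n => twoPoint q b).real {x | eraseAttack α x = 0} := by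
    intro b hb
    rcases max_choice (l / (2 * n)) (α / 2) with h | h
    · refine le_trans ?_ (pow_le_measureReal_eraseAttack_eq_zero hq0.le hq1' hb)
      have hlog : -(2 * q) ≤ Real.log (1 - q) := by
        have h1 := Real.one_sub_inv_le_log_of_pos (by linarith : 0 < 1 - q)
        refine le_trans ?_ h1
        have h2 : (1 - q)⁻¹ ≤ 1 + 2 * q := by
          rw [inv_le_iff_one_le_mul₀ (by linarith)]; nlinarith
        linarith
      have h1 : Real.exp (-(2 * q)) ≤ 1 - q := by
        rwa [← Real.le_log_iff_exp_le (by linarith)]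
      calc 2 * δ = Real.exp (-(2 * q)) ^ n := by
            rw [← Real.exp_nat_mul, ← hexpl, hq, h]
            congr 1
            field_simp
        _ ≤ (1 - q) ^ n := by gcongr
    · have hqα : q = α / 2 := h
      rw [hqα]
      refine le_trans (by linarith) (half_le_measureReal_eraseAttack_eq_zero hb (by linarith)
        (by norm_num at hα'; linarith) hn)
  -- No point is within less than qa of both qa and -qa, so the two far events cover the line and
  -- one has probability at least 1/2 under κ 0.
  have hfar : ∃ b : ℝ, |b| = a ∧ 1 / 2 ≤ (κ 0).real {t | q * a ≤ |t - q * b|} := by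
    by_contra hcon
    push Not at hcon
    have h1 := hcon a (abs_of_pos ha0)
    have h2 := hcon (-a) (by rw [abs_neg, abs_of_pos ha0])
    have hcover : {t | q * a ≤ |t - q * a|} ∪ {t | q * a ≤ |t - q * -a|} = Set.univ := by
      refine Set.eq_univ_of_forall fun t => ?_
      rcases le_total t 0 with ht | ht
      · left
        rw [Set.mem_ofPred_eq, le_abs]
        right; linarith
      · right
        rw [Set.mem_ofPred_eq, le_abs]
        left; linarith
    have h3 := measureReal_union_le (μ := κ 0) {t | q * a ≤ |t - q * a|} {t | q * a ≤ |t - q * -a|}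
    rw [hcover, probReal_univ] at h3
    linarith
  obtain ⟨b, hb, hfar⟩ := hfar
  have hb0 : b ≠ 0 := by rw [← abs_pos, hb]; exact ha0
  have := isProbabilityMeasure_twoPoint (a := b) hq0.le hq1'
  refine ⟨twoPoint q b, finiteMoment_twoPoint hq0.le hq1' _, hmoment b hb, eraseAttack α,
    measurable_eraseAttack α, isContamination_eraseAttack hα, ?_⟩
  rw [mean_twoPoint hq0.le hq1']
  have hs : MeasurableSet {t : ℝ | 1 / 16 * rate r v n δ α ≤ |t - q * b|} :=
    measurableSet_le measurable_const (measurable_id.sub_const _).abs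
  refine le_trans ?_ (mul_measureReal_le_comp_map (measurable_eraseAttack α) 0 hs)
  have h1 : 1 / 2 ≤ (κ 0).real {t : ℝ | 1 / 16 * rate r v n δ α ≤ |t - q * b|} :=
    hfar.trans (measureReal_mono fun t ht => hrate.trans ht)
  have h2 := hattack b hb0
  nlinarith

end MoM

/-- First part: the error bound for median-of-means. Second part: no estimator, even a randomized
one (a Markov kernel `κ` from contaminated samples to estimates) that knows `r`, `v`, `n`, `δ`
and `α`, has an error of smaller order over the distributions with absolute central moment `v`;
here `A` is the adversarial attack, and `κ ∘ₘ (Measure.pi fun _ => p).map A` is the law of the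
estimate. -/
theorem theorem3p3 (r : ℝ) (hr0 : 0 < r) (hr1 : r < 1) :
    (∃ C : ℝ → ℝ,
      (∃ c₁ c₂ : ℝ, 0 < c₁ ∧ 0 < c₂ ∧ ∀ γ : ℝ, 2 < γ → γ ≤ 2.5 →
        c₁ * (1 / 2 - 1 / γ) ^ (-((2 * r + 1) / (1 + r))) ≤ C γ ∧
        C γ ≤ c₂ * (1 / 2 - 1 / γ) ^ (-((2 * r + 1) / (1 + r)))) ∧
      ∀ (γ : ℝ), 2 < γ → γ ≤ 2.5 →
      ∀ (n : ℕ) (δ : ℝ), 2 * Real.exp (-(1 / 2 - 1 / γ) ^ 2 * n) < δ →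
      ∀ (p : Measure ℝ), MoM.FiniteMoment (1 + r) p →
      ∀ (α : ℝ), 0 ≤ α → α ≤ 0.4 →
      ∀ (Ω : Type*) [MeasurableSpace Ω] (P : Measure Ω) [IsProbabilityMeasure P]
        (Xs X : Fin n → Ω → ℝ)
        (I : Ω → MoM.Blocks n (MoM.numBlocks γ δ α n) (n / MoM.numBlocks γ δ α n)),
        MoM.IsExperiment P p α Xs X I →
        1 - δ ≤ P.real {ω | |MoM.estimator (I ω) (fun i => X i ω) - MoM.mean p| ≤
          C γ * MoM.rate r (MoM.centralMoment r p) n δ α}) ∧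
    (∃ c : ℝ, 0 < c ∧
      ∀ (n : ℕ) (δ : ℝ), Real.exp (-n) ≤ δ → δ ≤ 1 / 4 →
      ∀ (α : ℝ), 0 ≤ α → α ≤ 0.4 →
      ∀ (v : ℝ), 0 < v →
      ∀ (κ : Kernel (Fin n → ℝ) ℝ) [IsMarkovKernel κ],
      ∃ p : Measure ℝ, MoM.FiniteMoment (1 + r) p ∧ MoM.centralMoment r p = v ∧
      ∃ A : (Fin n → ℝ) → (Fin n → ℝ), Measurable A ∧ (∀ xs, MoM.IsContamination α xs (A xs)) ∧
        δ ≤ (κ ∘ₘ (Measure.pi fun _ => p).map A).real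
          {t : ℝ | c * MoM.rate r v n δ α ≤ |t - MoM.mean p|}) := by
  refine ⟨⟨fun γ => 80 * (1 / 2 - 1 / γ) ^ (-((2 * r + 1) / (1 + r))),
    ⟨80, 80, by norm_num, by norm_num, fun γ _ _ => ⟨le_rfl, le_rfl⟩⟩, ?_⟩,
    ⟨1 / 16, by norm_num, ?_⟩⟩
  · intro γ hγ hγ' n δ hδ p hp α hα hα' Ω _ P _ Xs X I hI
    exact MoM.IsExperiment.one_sub_le_measureReal hr0 hr1.le hγ hγ' hδ hp hα hα' rfl hI
  · intro n δ hδ hδ' α hα hα' v hv κ _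
    exact MoM.exists_attack hr0 hδ hδ' hα hα' hv κ
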